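/- Let $I=[a,b]$ with $a<b$, and let $I_1,\dots,I_N$ be nondegenerate closed intervals with pairwise disjoint interiors and $\bigcup_k I_k=I$. Let $f:I\to I$ be a piecewise linear expanding Markov map with this partition: for all $k,l$ either $f(\operatorname{int} I_k)\cap\operatorname{int} I_l=\emptyset$ or $\operatorname{int} I_l\subseteq f(\operatorname{int} I_k)$, and $f'(x)=\gamma_k$ for all $x\in\operatorname{int} I_k$, with constants satisfying $|\gamma_k|>1$. Write $f(x)=\gamma_k x+d_k$ on $\operatorname{int} I_k$, and let $A_{kl}=1$ if $\operatorname{int} I_l\subseteq f(\operatorname{int} I_k)$ and $A_{kl}=0$ otherwise. For $A_{lk}=1$ let $\varphi_{kl}(z)=(z-d_l)/\gamma_l$ be the (complexified) inverse branch from $I_k$ into $I_l$. Let $0<r<R$ and let $D_r\subset D_R$ be concentric open disks in $\mathbb C$ of radii $r$ and $R$ such that $\varphi_{kl}(D_R)\subset D_r$ for all inverse branches. Let $\mathcal H(D_R)$ be the Banach space of $N$-tuples $h=(h_1,\dots,h_N)$ of bounded holomorphic functions on $D_R$ with norm $\max_k\sup_{D_R}|h_k|$. Then $I\subset D_R$,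 so that each $h\in\mathcal H(D_R)$ defines a piecewise analytic function on $I$, equal to $h_k$ on $\operatorname{int} I_k$. For every real $\beta$ there is exactly one bounded operator $\mathcal L_\beta$ on $\mathcal H(D_R)$ such that, in terms of these piecewise analytic functions, for every $h$, $$(\mathcal L_\beta h)(x)=\sum_{y\in f^{-1}(x)}\frac{h(y)}{|f'(y)|^{\beta}}$$ for all but finitely many $x\in I$. The operator $\mathcal L_\beta$ is compact, and its nonzero eigenvalues, counted with algebraic multiplicity, are precisely the nonzero eigenvalues, counted with algebraic multiplicity, of the $N\times N$ matrices $T^{(mm)}(\beta)$, $m=0,1,2,\dots$, with entries $$T^{(mm)}_{kl}(\beta)=\frac{A_{lk}}{|\gamma_l|^{\beta}\gamma_l^{m}}.$$ That is, for every $\mu\in\mathbb C\setminus\{0\}$: $\mu$ is an eigenvalue of $\mathcal L_\beta$ if and only if it is an eigenvalue of some $T^{(mm)}(\beta)$; it is an eigenvalue of only finitely many of these matrices; and its algebraic multiplicity for $\mathcal L_\beta$ is finite and equals the sum over $m\ge 0$ of its algebraic multiplicities for $T^{(mm)}(\beta)$. -/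

import Mathlib

open Set Metric
open scoped BoundedContinuousFunction

/-- The space of bounded holomorphic functions on a set `D ⊆ ℂ` (used for open disks), as a
subspace of the bounded continuous functions on `D`; it carries the supremum norm. -/
def boundedHolomorphic (D : Set ℂ) : Submodule ℂ (D →ᵇ ℂ) where
  carrier := {g | ∃ F : ℂ → ℂ, DifferentiableOn ℂ F D ∧ ∀ z : D, g z = F z}
  add_mem' := by
    rintro g₁ g₂ ⟨F₁, h₁, e₁⟩ ⟨F₂, h₂, e₂⟩
    exact ⟨fun z => F₁ z + F₂ z, h₁.add h₂, fun z => by simp [e₁, e₂]⟩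
  zero_mem' := ⟨fun _ => 0, differentiableOn_const 0, fun _ => rfl⟩
  smul_mem' := by
    rintro c g ⟨F, h, e⟩
    exact ⟨fun z => c * F z, h.const_mul c, fun z => by simp [e]⟩

/-- `N`-tuples of bounded holomorphic functions on `D`, with the maximum of the sup norms. -/
abbrev TupleHolSpace (N : ℕ) (D : Set ℂ) : Type := Fin N → boundedHolomorphic D

/-- A partition of the closed interval `[a, b]` into finitely many nondegenerate closed intervals
`[left k, right k]` with disjoint interiors. -/
structure IntervalPartition (N : ℕ) where
  a : ℝ
  b : ℝ
  left : Fin N → ℝ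
  right : Fin N → ℝ
  a_lt_b : a < b
  left_lt_right : ∀ k, left k < right k
  disjoint_int : ∀ k l, k ≠ l → Disjoint (Ioo (left k) (right k)) (Ioo (left l) (right l))
  iUnion_eq : ⋃ k, Icc (left k) (right k) = Icc a b

namespace IntervalPartition

variable {N : ℕ} (P : IntervalPartition N) (f : ℝ → ℝ)

/-- The interval that is partitioned. -/
def I : Set ℝ := Icc P.a P.b

/-- The interior of the `k`-th partition element. -/
def int (k : Fin N) : Set ℝ := Ioo (P.left k) (P.right k)

/-- `f` restricts to a Markov map of the interval, with Markov partition `P`. Values of `f`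
outside the interval play no role. -/
structure IsMarkovMap : Prop where
  mapsTo : MapsTo f P.I P.I
  markov : ∀ k l, f '' P.int k ∩ P.int l = ∅ ∨ P.int l ⊆ f '' P.int k

/-- `|f'| > 1` on the interior of each partition element. (A nonzero `deriv` entails
differentiability.) -/
def IsExpanding : Prop := ∀ k, ∀ x ∈ P.int k, 1 < |deriv f x|

/-- `f'` exists and is constant on the interior of each partition element. -/
def IsPiecewiseLinear : Prop := ∀ k, ∃ γ : ℝ, ∀ x ∈ P.int k, HasDerivAt f γ x

open Classical in
/-- The topological transition matrix. -/
noncomputable def transitionMatrix : Matrix (Fin N) (Fin N) ℝ :=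
  Matrix.of fun k l => if P.int l ⊆ f '' P.int k then 1 else 0

/-- The slope of the `k`-th branch, read off at the midpoint of the partition element. -/
noncomputable def slope (k : Fin N) : ℝ := deriv f ((P.left k + P.right k) / 2)

/-- The intercept of the `k`-th branch, so that `f x = slope k * x + intercept k` on the interior
of the `k`-th element of a piecewise linear map. -/
noncomputable def intercept (k : Fin N) : ℝ :=
  f ((P.left k + P.right k) / 2) - P.slope f k * ((P.left k + P.right k) / 2)

/-- The analytic continuation of the inverse branch from the partition element `k` into the
partition element `l`; it is an inverse branch of `f` when `transitionMatrix l k = 1`. For a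
piecewise linear map it is the inverse of `x ↦ slope l * x + intercept l`, whatever `k` is. -/
noncomputable def invBranch (_k l : Fin N) (z : ℂ) : ℂ :=
  (z - (P.intercept f l : ℂ)) / (P.slope f l : ℂ)

/-- All inverse branches map the disk `D` into the disk `D'`. -/
def IsAdapted (D' D : Set ℂ) : Prop :=
  ∀ k l, P.transitionMatrix f l k = 1 → MapsTo (P.invBranch f k l) D D'

open Classical in
/-- The piecewise analytic function on the interval given by a tuple `h`: it equals `h k` on the
interior of the `k`-th partition element. (Its value at the finitely many endpoints is 0.) -/
noncomputable def piecewiseFun {D : Set ℂ} (h : TupleHolSpace N D) (x : ℝ) : ℂ :=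
  ∑ k, if hx : x ∈ P.int k ∧ (x : ℂ) ∈ D then (h k).1 ⟨(x : ℂ), hx.2⟩ else 0

/-- The generalised Perron-Frobenius operator on functions on the interval: the sum over all
preimages `y` of `x` of `h y / |f' y| ^ β`. -/
noncomputable def perronFrobenius (β : ℝ) (h : ℝ → ℂ) (x : ℝ) : ℂ :=
  ∑ᶠ y ∈ {y | y ∈ P.I ∧ f y = x}, h y / ((|deriv f y| ^ β : ℝ) : ℂ)

/-- `L` is the generalised Perron-Frobenius operator viewed as an operator on tuples of bounded
holomorphic functions: the piecewise analytic function given by `L h` is the image of the one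
given by `h`. Finitely many points are exempt, since a piecewise analytic function, and `f'`, have
no prescribed values at the endpoints of the partition elements. -/
def IsTransferOperator {D : Set ℂ} (β : ℝ) (L : TupleHolSpace N D →L[ℂ] TupleHolSpace N D) : Prop :=
  ∀ h : TupleHolSpace N D,
    {x | x ∈ P.I ∧ P.piecewiseFun (L h) x ≠ P.perronFrobenius f β (P.piecewiseFun h) x}.Finite

/-- The block `T^{(mn)}(β)`. The binomial coefficient `n.choose m` is `n.choose (n - m)` for
`m ≤ n`, and it is `0` for `n < m`, so that the block matrix is block upper triangular. -/
noncomputable def T (β : ℝ) (m n : ℕ) : Matrix (Fin N) (Fin N) ℂ :=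
  Matrix.of fun k l =>
    ((P.transitionMatrix f l k / (|P.slope f l| ^ β * P.slope f l ^ n)
      * (-P.intercept f l) ^ (n - m) * (n.choose m : ℝ) : ℝ) : ℂ)

end IntervalPartition

/-- The generalised eigenspace of a linear operator; its dimension is the algebraic multiplicity
of the eigenvalue. -/
abbrev genEigenspace {V : Type*} [AddCommGroup V] [Module ℂ V] (S : V →ₗ[ℂ] V) (μ : ℂ) :
    Submodule ℂ V :=
  Module.End.maxGenEigenspace S μ

/-!
For a piecewise linear Markov map the inverse branches are affine, and off the endpoints and their
images the Perron-Frobenius sum at `x` in the `k`-th partition element is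
`∑ l, A l k / |γ l| ^ β * h l (φ l x)`. This defines a weighted composition operator on tuples of
bounded holomorphic functions (`isTransferOperator_weightedComp`), and the identity theorem makes it
the only one (`IsTransferOperator.unique`).

The inverse branches map the disk of radius `R` into the one of radius `r < R`. By Cauchy's
estimates, replacing a tuple by its Taylor polynomials of degree less than `M` at the centre changes
its image by at most a constant times `(r / R) ^ M`
(`norm_weightedComp_sub_comp_taylorProj_le`). Hence the operator is a norm limit of operators of
finite rank, so it is compact.

Affine substitutions preserve the space `V` of tuples of polynomials of degree less than `M`. When
the error above is smaller than `|μ|`, every generalised eigenvector for `μ` lies in `V`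
(`maxGenEigenspace_le_of_norm_sub_comp_lt`): modulo `V` the operator has norm less than `|μ|`. On
`V`, in the basis of monomials in `z - z₀`, it is block triangular, and its diagonal blocks are the
matrices `T m m`, `m < M`; these do not depend on the centre of expansion. So the multiplicity of
`μ` is the sum of its multiplicities for the blocks with `m < M`. This holds for all large `M`,
which forces the later blocks to contribute nothing.
-/

/-! ### Generalised eigenspaces and compactness through finite-dimensional approximation -/

/-- If `L` preserves the finite-dimensional space `V`, `Q` takes values in `V`, and `L` is within
`|μ|` of `L ∘ Q`, then all generalised eigenvectors of `L` for `μ` lie in `V`: the operator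
`S = L - L ∘ Q` agrees with `L` modulo `V`, and `S - μ` is injective and maps `V` onto `V`. -/
theorem maxGenEigenspace_le_of_norm_sub_comp_lt {E : Type*} [NormedAddCommGroup E]
    [NormedSpace ℂ E] {L Q : E →L[ℂ] E} {V : Submodule ℂ E} [FiniteDimensional ℂ V] {μ : ℂ}
    (hL : ∀ v ∈ V, L v ∈ V) (hQ : ∀ u, Q u ∈ V) (hμ : ‖L - L.comp Q‖ < ‖μ‖) :
    Module.End.maxGenEigenspace (L : E →ₗ[ℂ] E) μ ≤ V := by
  set S : E →L[ℂ] E := L - L.comp Q with hS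
  have hSV : ∀ v ∈ V, S v ∈ V := fun v hv => V.sub_mem (hL v hv) (hL _ (hQ v))
  have hinj : ∀ u, S u = μ • u → u = 0 := by
    intro u hu
    by_contra hne
    have h1 : ‖μ‖ * ‖u‖ ≤ ‖S‖ * ‖u‖ := by
      rw [← norm_smul, ← hu]
      exact S.le_opNorm u
    exact absurd (le_of_mul_le_mul_right h1 (norm_pos_iff.2 hne)) (not_le.2 hμ)
  -- `S - μ` restricts to an injective, hence surjective, endomorphism of `V`.
  let A : V →ₗ[ℂ] V := ((S : E →ₗ[ℂ] E) - μ • LinearMap.id).restrict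
    (p := V) (q := V) (fun v hv => V.sub_mem (hSV v hv) (V.smul_mem μ hv))
  have hA : ∀ v : V, ((A v : V) : E) = S v - μ • (v : E) := fun v => rfl
  have hAinj : Function.Injective A := by
    rw [← LinearMap.ker_eq_bot, LinearMap.ker_eq_bot']
    intro v hv
    have := hA v
    rw [hv] at this
    exact Subtype.ext (hinj v (sub_eq_zero.1 this.symm))
  have hAsurj := LinearMap.injective_iff_surjective.1 hAinj
  have key : ∀ u, L u - μ • u ∈ V → u ∈ V := by
    intro u hu
    have h1 : S u - μ • u ∈ V := by
      have : S u - μ • u = (L u - μ • u) - L (Q u) := by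
        simp only [hS, sub_apply, ContinuousLinearMap.comp_apply]
        abel
      rw [this]
      exact V.sub_mem hu (hL _ (hQ u))
    obtain ⟨v, hv⟩ := hAsurj ⟨_, h1⟩
    have h2 : S v - μ • (v : E) = S u - μ • u := by rw [← hA, hv]
    have h3 : u - v = 0 := by
      apply hinj
      rw [map_sub, smul_sub]
      rw [sub_eq_sub_iff_add_eq_add] at h2 ⊢
      rw [← h2, add_comm]
    rw [sub_eq_zero.1 h3]
    exact v.2
  intro u hu
  obtain ⟨k, hk⟩ := (Module.End.mem_maxGenEigenspace _ _ _).1 hu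
  have : ∀ k : ℕ, ∀ u, (((L : E →ₗ[ℂ] E) - μ • (1 : Module.End ℂ E)) ^ k) u ∈ V → u ∈ V := by
    intro k
    induction k with
    | zero => intro u hu; simpa using hu
    | succ k ih =>
      intro u hu
      rw [pow_succ] at hu
      exact key u (ih _ hu)
  exact this k u (by rw [hk]; exact V.zero_mem)

theorem isCompactOperator_of_norm_sub_comp_le {E : Type*} [NormedAddCommGroup E]
    [NormedSpace ℂ E] [CompleteSpace E] {L : E →L[ℂ] E} {Q : ℕ → E →L[ℂ] E} {b : ℕ → ℝ}
    (hQ : ∀ n, IsCompactOperator (Q n)) (hle : ∀ n, ‖L - L.comp (Q n)‖ ≤ b n)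
    (hb : Filter.Tendsto b Filter.atTop (nhds 0)) : IsCompactOperator L := by
  have hlim : Filter.Tendsto (fun n => L.comp (Q n)) Filter.atTop (nhds L) := by
    rw [tendsto_iff_norm_sub_tendsto_zero]
    refine squeeze_zero (fun n => norm_nonneg _) (fun n => ?_) hb
    rw [norm_sub_rev]
    exact hle n
  exact isCompactOperator_of_tendsto hlim (Filter.Eventually.of_forall fun n => (hQ n).clm_comp L)

/-- The algebraic multiplicity of `μ` can be computed on any embedded invariant subspace that
contains the generalised eigenspace. -/
theorem finrank_maxGenEigenspace_eq_of_intertwining {K E F : Type*} [Field K] [AddCommGroup E]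
    [Module K E] [AddCommGroup F] [Module K F] {S : Module.End K E} {B : Module.End K F}
    {j : F →ₗ[K] E} (hj : Function.Injective j) (hcomm : ∀ v, S (j v) = j (B v)) {μ : K}
    (hle : S.maxGenEigenspace μ ≤ LinearMap.range j) :
    Module.finrank K (S.maxGenEigenspace μ) = Module.finrank K (B.maxGenEigenspace μ) := by
  have hpow : ∀ (k : ℕ) v, ((S - μ • 1) ^ k) (j v) = j (((B - μ • 1) ^ k) v) := by
    intro k
    induction k with
    | zero => intro v; simp
    | succ k ih =>
      intro v
      have h1 : (S - μ • 1) (j v) = j ((B - μ • 1) v) := by simp [hcomm]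
      rw [pow_succ, pow_succ, Module.End.mul_apply, Module.End.mul_apply, h1, ih]
  have hmap : S.maxGenEigenspace μ = (B.maxGenEigenspace μ).map j := by
    ext u
    rw [Submodule.mem_map]
    constructor
    · intro hu
      obtain ⟨v, rfl⟩ := hle hu
      refine ⟨v, ?_, rfl⟩
      obtain ⟨k, hk⟩ := (Module.End.mem_maxGenEigenspace _ _ _).1 hu
      rw [hpow] at hk
      exact (Module.End.mem_maxGenEigenspace _ _ _).2 ⟨k, hj (by rw [hk, map_zero])⟩
    · rintro ⟨v, hv, rfl⟩
      obtain ⟨k, hk⟩ := (Module.End.mem_maxGenEigenspace _ _ _).1 hv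
      exact (Module.End.mem_maxGenEigenspace _ _ _).2 ⟨k, by rw [hpow, hk, map_zero]⟩
  rw [hmap]
  exact (Submodule.equivMapOfInjective j hj _).finrank_eq.symm

theorem hasEigenvalue_iff_maxGenEigenspace_ne_bot {K E : Type*} [Field K] [AddCommGroup E]
    [Module K E] {S : Module.End K E} {μ : K} :
    S.HasEigenvalue μ ↔ S.maxGenEigenspace μ ≠ ⊥ := by
  constructor
  · intro h h0
    exact h (le_bot_iff.1 (h0 ▸ Module.End.eigenspace_le_maxGenEigenspace))
  · intro h h0
    apply h
    rw [Submodule.eq_bot_iff]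
    intro u hu
    have hinj : ∀ v, (S - μ • 1) v = 0 → v = 0 := by
      intro v hv
      have : v ∈ S.eigenspace μ := by
        rw [Module.End.mem_eigenspace_iff]
        simpa [sub_eq_zero] using hv
      exact (Submodule.eq_bot_iff _).1 h0 v this
    obtain ⟨k, hk⟩ := (Module.End.mem_maxGenEigenspace _ _ _).1 hu
    induction k with
    | zero => simpa using hk
    | succ k ih =>
      rw [pow_succ'] at hk
      exact ih (hinj _ hk)

theorem finrank_maxGenEigenspace_toLin' {K ι : Type*} [Field K] [Fintype ι] [DecidableEq ι]
    (A : Matrix ι ι K) (μ : K) :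
    Module.finrank K (Module.End.maxGenEigenspace (Matrix.toLin' A) μ) =
      A.charpoly.rootMultiplicity μ := by
  rw [LinearMap.finrank_maxGenEigenspace_eq, Matrix.charpoly_toLin']

theorem rootMultiplicity_prod_eq_sum {K α : Type*} [Field K] (s : Finset α)
    (p : α → Polynomial K) (hp : ∀ i ∈ s, p i ≠ 0) (μ : K) :
    (∏ i ∈ s, p i).rootMultiplicity μ = ∑ i ∈ s, (p i).rootMultiplicity μ := by
  classical
  induction s using Finset.induction_on with
  | empty => simp [Polynomial.rootMultiplicity_eq_zero]
  | insert a s ha ih =>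
    have h1 : ∀ i ∈ s, p i ≠ 0 := fun i hi => hp i (Finset.mem_insert_of_mem hi)
    rw [Finset.prod_insert ha, Finset.sum_insert ha, Polynomial.rootMultiplicity_mul, ih h1]
    exact mul_ne_zero (hp a (Finset.mem_insert_self _ _)) (Finset.prod_ne_zero_iff.2 h1)

theorem finrank_maxGenEigenspace_toLin'_blockTriangular {K ι : Type*} [Field K] [Fintype ι]
    [DecidableEq ι] {M : ℕ} [Nonempty ι] (B : Matrix (Fin M × ι) (Fin M × ι) K)
    (T : ℕ → Matrix ι ι K)
    (hB : B.BlockTriangular Prod.fst) (hT : ∀ m k l, B (m, k) (m, l) = T m k l) (μ : K) :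
    Module.finrank K (Module.End.maxGenEigenspace (Matrix.toLin' B) μ) =
      ∑ m ∈ Finset.range M,
        Module.finrank K (Module.End.maxGenEigenspace (Matrix.toLin' (T m)) μ) := by
  have himg : Finset.image (Prod.fst : Fin M × ι → Fin M) Finset.univ = Finset.univ := by
    rw [Finset.eq_univ_iff_forall]
    intro m
    exact Finset.mem_image.2 ⟨(m, Classical.arbitrary ι), Finset.mem_univ _, rfl⟩
  have hblock : ∀ m : Fin M, (B.toSquareBlock Prod.fst m).charpoly = (T m).charpoly := by
    intro m
    let e : {i : Fin M × ι // i.1 = m} ≃ ι :=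
      { toFun := fun i => i.1.2
        invFun := fun k => ⟨(m, k), rfl⟩
        left_inv := by rintro ⟨⟨m', k⟩, rfl⟩; rfl
        right_inv := fun k => rfl }
    rw [← Matrix.charpoly_reindex e]
    congr 1
    ext k l
    exact hT m k l
  simp only [finrank_maxGenEigenspace_toLin']
  rw [hB.charpoly, himg,
    rootMultiplicity_prod_eq_sum _ _ (fun m _ => (Matrix.charpoly_monic _).ne_zero),
    Finset.sum_range]
  exact Finset.sum_congr rfl fun m _ => by rw [hblock]

/-! ### Bounded holomorphic functions -/

namespace boundedHolomorphic

section General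

variable {D : Set ℂ}

open Classical in
/-- The extension by zero of a bounded holomorphic function on `D` to the whole plane. -/
noncomputable def zeroExtend (h : boundedHolomorphic D) (z : ℂ) : ℂ :=
  if hz : z ∈ D then h.1 ⟨z, hz⟩ else 0

theorem zeroExtend_of_mem (h : boundedHolomorphic D) {z : ℂ} (hz : z ∈ D) :
    zeroExtend h z = h.1 ⟨z, hz⟩ := dif_pos hz

theorem zeroExtend_add (g h : boundedHolomorphic D) :
    zeroExtend (g + h) = zeroExtend g + zeroExtend h := by
  ext z
  by_cases hz : z ∈ D <;> simp [zeroExtend, hz]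

theorem zeroExtend_smul (c : ℂ) (h : boundedHolomorphic D) :
    zeroExtend (c • h) = c • zeroExtend h := by
  ext z
  by_cases hz : z ∈ D <;> simp [zeroExtend, hz]

theorem differentiableOn_zeroExtend (h : boundedHolomorphic D) :
    DifferentiableOn ℂ (zeroExtend h) D := by
  obtain ⟨F, hF, e⟩ := h.2
  exact hF.congr fun z hz => by rw [zeroExtend_of_mem h hz, e]

theorem norm_apply_le (h : boundedHolomorphic D) (z : D) : ‖h.1 z‖ ≤ ‖h‖ :=
  h.1.norm_coe_le_norm z

theorem norm_zeroExtend_le (h : boundedHolomorphic D) (z : ℂ) : ‖zeroExtend h z‖ ≤ ‖h‖ := by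
  by_cases hz : z ∈ D
  · rw [zeroExtend_of_mem h hz]
    exact norm_apply_le h _
  · rw [zeroExtend, dif_neg hz, norm_zero]
    exact norm_nonneg _

theorem norm_le_of_forall {h : boundedHolomorphic D} {C : ℝ} (hC : 0 ≤ C)
    (H : ∀ z, ‖h.1 z‖ ≤ C) : ‖h‖ ≤ C :=
  (BoundedContinuousFunction.norm_le hC).2 H

/-- Uniform limits of holomorphic functions are holomorphic, so the space is complete. -/
theorem isClosed (hD : IsOpen D) : IsClosed (boundedHolomorphic D : Set (D →ᵇ ℂ)) := by
  rw [← isSeqClosed_iff_isClosed]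
  intro u g hu hg
  let v : ℕ → boundedHolomorphic D := fun n => ⟨u n, hu n⟩
  classical
  let F : ℂ → ℂ := fun z => if hz : z ∈ D then g ⟨z, hz⟩ else 0
  have hF : ∀ z : D, F z = g z := fun z => dif_pos z.2
  refine ⟨F, ?_, fun z => (hF z).symm⟩
  have hlim : TendstoUniformlyOn (fun n => zeroExtend (v n)) F Filter.atTop D := by
    rw [tendstoUniformlyOn_iff_tendstoUniformly_comp_coe]
    have h1 := BoundedContinuousFunction.tendsto_iff_tendstoUniformly.1 hg
    have e1 : (fun n (z : D) => zeroExtend (v n) z) = fun n => ⇑(u n) := by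
      funext n z
      exact zeroExtend_of_mem (v n) z.2
    have e2 : F ∘ ((↑) : D → ℂ) = g := funext hF
    rw [e2]
    exact e1 ▸ h1
  exact hlim.tendstoLocallyUniformlyOn.differentiableOn
    (Filter.Eventually.of_forall fun n => differentiableOn_zeroExtend (v n)) hD

/-- Composition with a holomorphic self-map of `D`, as a bounded operator. -/
noncomputable def compCLM (φ : ℂ → ℂ) (hφ : DifferentiableOn ℂ φ D) (hmaps : MapsTo φ D D) :
    boundedHolomorphic D →L[ℂ] boundedHolomorphic D :=
  ((BoundedContinuousFunction.compContinuousCLM ℂ ℂ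
      ⟨hmaps.restrict φ D D, hφ.continuousOn.mapsToRestrict hmaps⟩).comp
    (boundedHolomorphic D).subtypeL).codRestrict (boundedHolomorphic D) fun h =>
      ⟨zeroExtend h ∘ φ, (differentiableOn_zeroExtend h).comp hφ hmaps, fun z =>
        (zeroExtend_of_mem h (hmaps z.2)).symm⟩

@[simp]
theorem compCLM_apply {φ : ℂ → ℂ} (hφ : DifferentiableOn ℂ φ D) (hmaps : MapsTo φ D D)
    (h : boundedHolomorphic D) (z : D) :
    (compCLM φ hφ hmaps h).1 z = h.1 ⟨φ z, hmaps z.2⟩ := rfl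

end General

section Disk

variable {z₀ : ℂ} {R : ℝ}

/-- The function `z ↦ (z - z₀) ^ m` on the disk of radius `R` around `z₀`. -/
noncomputable def monomial (z₀ : ℂ) (R : ℝ) (m : ℕ) : boundedHolomorphic (ball z₀ R) :=
  ⟨BoundedContinuousFunction.ofNormedAddCommGroup (fun z : ball z₀ R => ((z : ℂ) - z₀) ^ m)
    (by fun_prop) (R ^ m) fun z => by
      rw [norm_pow]
      exact pow_le_pow_left₀ (norm_nonneg _) (mem_ball_iff_norm.1 z.2).le m,
    fun z => (z - z₀) ^ m, by fun_prop, fun _ => rfl⟩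

@[simp]
theorem monomial_apply (m : ℕ) (z : ball z₀ R) :
    (monomial z₀ R m).1 z = ((z : ℂ) - z₀) ^ m := rfl

theorem contDiffAt_zeroExtend (hR : 0 < R) (h : boundedHolomorphic (ball z₀ R)) (m : ℕ) :
    ContDiffAt ℂ m (zeroExtend h) z₀ :=
  ((differentiableOn_zeroExtend h).analyticAt (isOpen_ball.mem_nhds (mem_ball_self hR))).contDiffAt

/-- Cauchy's estimate, with the full radius `R` although `h` need not extend to the boundary. -/
theorem norm_taylorCoeff_le (hR : 0 < R) (h : boundedHolomorphic (ball z₀ R)) (m : ℕ) :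
    ‖(m.factorial : ℂ)⁻¹ * iteratedDeriv m (zeroExtend h) z₀‖ ≤ (R ^ m)⁻¹ * ‖h‖ := by
  have hbound : ∀ z, ‖zeroExtend h z‖ ≤ ‖h‖ := norm_zeroExtend_le h
  generalize ‖h‖ = C at hbound ⊢
  set c := (m.factorial : ℂ)⁻¹ * iteratedDeriv m (zeroExtend h) z₀ with hc
  have hsmall : ∀ ρ ∈ Ioo 0 R, ‖c‖ * ρ ^ m ≤ C := by
    intro ρ hρ
    have hd : DiffContOnCl ℂ (zeroExtend h) (ball z₀ ρ) :=
      ((differentiableOn_zeroExtend h).mono (closedBall_subset_ball hρ.2)).diffContOnCl_ball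
        Subset.rfl
    have h1 := Complex.norm_iteratedDeriv_le_of_forall_mem_sphere_norm_le m hρ.1 hd
      (fun z _ => hbound z)
    rw [hc, norm_mul, norm_inv, Complex.norm_natCast]
    have hf : (0 : ℝ) < m.factorial := by positivity
    have hp : 0 < ρ ^ m := pow_pos hρ.1 m
    rw [le_div_iff₀ hp] at h1
    calc (m.factorial : ℝ)⁻¹ * ‖iteratedDeriv m (zeroExtend h) z₀‖ * ρ ^ m
        = (m.factorial : ℝ)⁻¹ * (‖iteratedDeriv m (zeroExtend h) z₀‖ * ρ ^ m) := by ring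
      _ ≤ (m.factorial : ℝ)⁻¹ * (m.factorial * C) := by gcongr
      _ = C := by field_simp
  have hR' : ‖c‖ * R ^ m ≤ C := by
    have hmem : R ∈ closure (Ioo 0 R) := by
      rw [closure_Ioo hR.ne]
      exact ⟨hR.le, le_rfl⟩
    exact ContinuousWithinAt.closure_le (f := fun ρ : ℝ => ‖c‖ * ρ ^ m) (g := fun _ => C) hmem
      (by fun_prop) (by fun_prop) hsmall
  rw [← div_eq_inv_mul, le_div_iff₀ (pow_pos hR m)]
  exact hR'

/-- The `m`-th Taylor coefficient at the centre of the disk, as a bounded functional. -/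
noncomputable def taylorCoeff (hR : 0 < R) (m : ℕ) : boundedHolomorphic (ball z₀ R) →L[ℂ] ℂ :=
  LinearMap.mkContinuous
    { toFun := fun h => (m.factorial : ℂ)⁻¹ * iteratedDeriv m (zeroExtend h) z₀
      map_add' := fun g h => by
        rw [zeroExtend_add, iteratedDeriv_add (contDiffAt_zeroExtend hR g m)
          (contDiffAt_zeroExtend hR h m), mul_add]
      map_smul' := fun c h => by
        rw [zeroExtend_smul, iteratedDeriv_const_smul (contDiffAt_zeroExtend hR h m)]
        simp only [smul_eq_mul, RingHom.id_apply]
        ring }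
    (R ^ m)⁻¹ (fun h => norm_taylorCoeff_le hR h m)

theorem taylorCoeff_apply (hR : 0 < R) (m : ℕ) (h : boundedHolomorphic (ball z₀ R)) :
    taylorCoeff hR m h = (m.factorial : ℂ)⁻¹ * iteratedDeriv m (zeroExtend h) z₀ := rfl

theorem norm_taylorCoeff_apply_le (hR : 0 < R) (h : boundedHolomorphic (ball z₀ R)) (m : ℕ) :
    ‖taylorCoeff hR m h‖ ≤ (R ^ m)⁻¹ * ‖h‖ :=
  norm_taylorCoeff_le hR h m

theorem hasSum_taylorCoeff (hR : 0 < R) (h : boundedHolomorphic (ball z₀ R)) (z : ball z₀ R) :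
    HasSum (fun m => taylorCoeff hR m h * ((z : ℂ) - z₀) ^ m) (h.1 z) := by
  have h1 := Complex.hasSum_taylorSeries_on_ball (differentiableOn_zeroExtend h) z.2
  rw [zeroExtend_of_mem h z.2] at h1
  have e : (fun m => taylorCoeff hR m h * ((z : ℂ) - z₀) ^ m) = fun m : ℕ =>
      (m.factorial : ℂ)⁻¹ • ((z : ℂ) - z₀) ^ m • iteratedDeriv m (zeroExtend h) z₀ := by
    funext m
    rw [taylorCoeff_apply, smul_eq_mul, smul_eq_mul]
    ring
  rw [e]
  exact h1

/-- On a smaller concentric disk the Taylor polynomials converge geometrically, uniformly over the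
unit ball of the space. -/
theorem norm_taylorPolynomial_sub_le {r : ℝ} (hr : 0 < r) (hrR : r < R)
    (h : boundedHolomorphic (ball z₀ R)) (M : ℕ) (z : ball z₀ R) (hz : (z : ℂ) ∈ ball z₀ r) :
    ‖(∑ m ∈ Finset.range M, taylorCoeff (hr.trans hrR) m h * ((z : ℂ) - z₀) ^ m) - h.1 z‖ ≤
      ‖h‖ * (r / R) ^ M / (1 - r / R) := by
  have hR := hr.trans hrR
  refine norm_sub_le_of_geometric_bound_of_hasSum ((div_lt_one hR).2 hrR) (fun m => ?_)
    (hasSum_taylorCoeff hR h z) M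
  rw [norm_mul, norm_pow]
  calc ‖taylorCoeff hR m h‖ * ‖(z : ℂ) - z₀‖ ^ m ≤ (R ^ m)⁻¹ * ‖h‖ * r ^ m := by
        gcongr
        · exact norm_taylorCoeff_apply_le hR h m
        · exact (mem_ball_iff_norm.1 hz).le
    _ = ‖h‖ * (r / R) ^ m := by rw [div_pow]; ring

/-- The identity theorem on the disk. -/
theorem eq_of_frequently_eq {g h : boundedHolomorphic (ball z₀ R)} {w : ℂ} (hw : w ∈ ball z₀ R)
    (hgh : ∃ᶠ z in nhdsWithin w {w}ᶜ, zeroExtend g z = zeroExtend h z) : g = h := by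
  have h1 := AnalyticOnNhd.eqOn_of_preconnected_of_frequently_eq
    ((differentiableOn_zeroExtend g).analyticOnNhd isOpen_ball)
    ((differentiableOn_zeroExtend h).analyticOnNhd isOpen_ball)
    (convex_ball z₀ R).isPreconnected hw hgh
  refine Subtype.ext (BoundedContinuousFunction.ext fun z => ?_)
  rw [← zeroExtend_of_mem g z.2, ← zeroExtend_of_mem h z.2]
  exact h1 z.2

end Disk

end boundedHolomorphic

/-! ### Markov partitions and inverse branches -/

namespace IntervalPartition

variable {N : ℕ} {P : IntervalPartition N} {f : ℝ → ℝ}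

/-- The endpoints of the partition elements. -/
def endpoints (P : IntervalPartition N) : Set ℝ := range P.left ∪ range P.right

theorem finite_endpoints (P : IntervalPartition N) : P.endpoints.Finite :=
  (finite_range _).union (finite_range _)

theorem exists_mem_int {x : ℝ} (hx : x ∈ P.I) (hx' : x ∉ P.endpoints) : ∃ k, x ∈ P.int k := by
  have h1 : x ∈ ⋃ k, Icc (P.left k) (P.right k) := by rw [P.iUnion_eq]; exact hx
  obtain ⟨k, hk⟩ := mem_iUnion.1 h1
  refine ⟨k, lt_of_le_of_ne hk.1 ?_, lt_of_le_of_ne hk.2 ?_⟩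
  · rintro rfl
    exact hx' (Or.inl ⟨k, rfl⟩)
  · rintro rfl
    exact hx' (Or.inr ⟨k, rfl⟩)

theorem eq_of_mem_int {x : ℝ} {k l : Fin N} (hk : x ∈ P.int k) (hl : x ∈ P.int l) : k = l := by
  by_contra h
  exact disjoint_left.1 (P.disjoint_int k l h) hk hl

theorem int_subset (k : Fin N) : P.int k ⊆ P.I := by
  intro x hx
  have : x ∈ ⋃ k, Icc (P.left k) (P.right k) := mem_iUnion.2 ⟨k, Ioo_subset_Icc_self hx⟩
  rwa [P.iUnion_eq] at this

theorem mem_int_midpoint (k : Fin N) : (P.left k + P.right k) / 2 ∈ P.int k := by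
  have := P.left_lt_right k
  constructor <;> linarith

theorem nonempty_index (P : IntervalPartition N) : Nonempty (Fin N) := by
  have h1 : P.a ∈ ⋃ k, Icc (P.left k) (P.right k) := by
    rw [P.iUnion_eq]
    exact ⟨le_rfl, P.a_lt_b.le⟩
  obtain ⟨k, -⟩ := mem_iUnion.1 h1
  exact ⟨k⟩

theorem infinite_int (P : IntervalPartition N) (k : Fin N) : (P.int k).Infinite :=
  Ioo_infinite (P.left_lt_right k)

theorem hasDerivAt_slope (hPL : P.IsPiecewiseLinear f) {k : Fin N} {x : ℝ} (hx : x ∈ P.int k) :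
    HasDerivAt f (P.slope f k) x := by
  obtain ⟨γ, hγ⟩ := hPL k
  have : P.slope f k = γ := (hγ _ (mem_int_midpoint k)).deriv
  exact this ▸ hγ x hx

theorem one_lt_abs_slope (hE : P.IsExpanding f) (k : Fin N) : 1 < |P.slope f k| :=
  hE k _ (mem_int_midpoint k)

theorem slope_ne_zero (hE : P.IsExpanding f) (k : Fin N) : P.slope f k ≠ 0 :=
  abs_pos.1 (one_pos.trans (one_lt_abs_slope hE k))

/-- A branch is given by its affine formula on the whole open partition element. -/
theorem apply_eq (hPL : P.IsPiecewiseLinear f) {k : Fin N} {x : ℝ} (hx : x ∈ P.int k) :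
    f x = P.slope f k * x + P.intercept f k := by
  have hd : ∀ y ∈ P.int k, HasDerivAt (fun y => f y - P.slope f k * y) 0 y := by
    intro y hy
    have := (hasDerivAt_slope hPL hy).sub ((hasDerivAt_id y).const_mul (P.slope f k))
    rw [mul_one, sub_self] at this
    exact this
  have h1 := IsOpen.is_const_of_deriv_eq_zero (f := fun y => f y - P.slope f k * y)
    (s := P.int k) isOpen_Ioo isPreconnected_Ioo
    (fun y hy => (hd y hy).differentiableAt.differentiableWithinAt) (fun y hy => (hd y hy).deriv)
    hx (mem_int_midpoint k)
  rw [intercept]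
  linear_combination h1

theorem injOn_int (hPL : P.IsPiecewiseLinear f) (hE : P.IsExpanding f) (k : Fin N) :
    InjOn f (P.int k) := by
  intro x hx y hy h
  rw [apply_eq hPL hx, apply_eq hPL hy] at h
  exact mul_left_cancel₀ (slope_ne_zero hE k) (add_right_cancel h)

theorem transitionMatrix_eq_one_iff {k l : Fin N} :
    P.transitionMatrix f k l = 1 ↔ P.int l ⊆ f '' P.int k := by
  simp [transitionMatrix]

theorem transitionMatrix_eq_zero_iff {k l : Fin N} :
    P.transitionMatrix f k l = 0 ↔ ¬ P.int l ⊆ f '' P.int k := by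
  simp [transitionMatrix]

/-- Every branch has a transition: the image of a partition element is infinite, so it meets the
interior of some other element. -/
theorem exists_transitionMatrix_eq_one (hM : P.IsMarkovMap f) (hE : P.IsExpanding f)
    (hPL : P.IsPiecewiseLinear f) (l : Fin N) : ∃ k, P.transitionMatrix f l k = 1 := by
  have hinf : (f '' P.int l).Infinite := (P.infinite_int l).image (injOn_int hPL hE l)
  obtain ⟨x, hx, hx'⟩ := hinf.exists_notMem_finite P.finite_endpoints
  have hxI : x ∈ P.I := by
    obtain ⟨y, hy, rfl⟩ := hx
    exact hM.mapsTo (int_subset l hy)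
  obtain ⟨k, hk⟩ := exists_mem_int hxI hx'
  refine ⟨k, transitionMatrix_eq_one_iff.2 ((hM.markov l k).resolve_left ?_)⟩
  exact Set.Nonempty.ne_empty ⟨x, hx, hk⟩

/-- `IsAdapted` constrains only pairs with a transition, but `invBranch` ignores its first index and
every branch has a transition. -/
theorem mapsTo_invBranch (hM : P.IsMarkovMap f) (hE : P.IsExpanding f)
    (hPL : P.IsPiecewiseLinear f) {D' D : Set ℂ} (hA : P.IsAdapted f D' D) (k l : Fin N) :
    MapsTo (P.invBranch f k l) D D' := by
  obtain ⟨k', hk'⟩ := exists_transitionMatrix_eq_one hM hE hPL l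
  exact hA k' l hk'

theorem invBranch_sub_center (k l : Fin N) (z₀ z : ℂ) :
    P.invBranch f k l z - z₀ =
      (P.slope f l : ℂ)⁻¹ * (z - z₀) + (P.invBranch f k l z₀ - z₀) := by
  simp only [invBranch, div_eq_mul_inv]
  ring

theorem invBranch_apply_of_mem (hE : P.IsExpanding f) (hPL : P.IsPiecewiseLinear f) (k : Fin N)
    {l : Fin N} {y : ℝ} (hy : y ∈ P.int l) : P.invBranch f k l (f y : ℂ) = y := by
  have h0 : (P.slope f l : ℂ) ≠ 0 := by exact_mod_cast slope_ne_zero hE l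
  rw [invBranch, apply_eq hPL hy, div_eq_iff h0]
  push_cast
  ring

/-- An affine map `z ↦ z₀ + a (z - z₀) + c` that maps the disk of radius `R` around `z₀` into the
one of radius `r` satisfies `|a| R + |c| ≤ r`: along a ray on which `a (z - z₀)` has the argument
of `c`, norms add up. -/
theorem norm_mul_add_norm_le_of_mapsTo {z₀ a c : ℂ} {r R : ℝ} (hR : 0 < R)
    (h : ∀ z ∈ ball z₀ R, ‖a * (z - z₀) + c‖ < r) : ‖a‖ * R + ‖c‖ ≤ r := by
  set u : ℂ := Complex.exp (((c.arg - a.arg : ℝ) : ℂ) * Complex.I) with hu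
  have hu1 : ‖u‖ = 1 := Complex.norm_exp_ofReal_mul_I _
  have hray : ∀ t ∈ Ioo 0 R, ‖a‖ * t + ‖c‖ ≤ r := by
    intro t ht
    have hau : a * u = ‖a‖ * Complex.exp (c.arg * Complex.I) := by
      conv_lhs => rw [← Complex.norm_mul_exp_arg_mul_I a]
      rw [hu, mul_assoc, ← Complex.exp_add]
      congr 2
      push_cast
      ring
    have hsum : a * ((t : ℂ) * u) + c =
        ((‖a‖ * t + ‖c‖ : ℝ) : ℂ) * Complex.exp (c.arg * Complex.I) := by
      conv_lhs => rw [← Complex.norm_mul_exp_arg_mul_I c]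
      push_cast
      linear_combination (t : ℂ) * hau
    have hnonneg : 0 ≤ ‖a‖ * t + ‖c‖ := by
      have := ht.1
      positivity
    have hz : z₀ + (t : ℂ) * u ∈ ball z₀ R := by
      rw [mem_ball_iff_norm, add_sub_cancel_left, norm_mul, hu1, mul_one, Complex.norm_real,
        Real.norm_of_nonneg ht.1.le]
      exact ht.2
    have h1 := h _ hz
    rw [add_sub_cancel_left, hsum, norm_mul, Complex.norm_exp_ofReal_mul_I, mul_one,
      Complex.norm_real, Real.norm_of_nonneg hnonneg] at h1
    exact h1.le
  have hmem : R ∈ closure (Ioo 0 R) := by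
    rw [closure_Ioo hR.ne]
    exact ⟨hR.le, le_rfl⟩
  exact ContinuousWithinAt.closure_le (f := fun t : ℝ => ‖a‖ * t + ‖c‖) (g := fun _ => r) hmem
    (by fun_prop) (by fun_prop) hray

/-- The interval lies in the large disk. If the largest distance `m` of a point of the interval
from the centre were at least `R`, the estimate `|a| R + |c| ≤ r` for an inverse branch would give
`m ≤ |a| m + |c| ≤ r + |a| (m - R) < m`. -/
theorem mem_ball_of_isAdapted (hM : P.IsMarkovMap f) (hE : P.IsExpanding f)
    (hPL : P.IsPiecewiseLinear f) {z₀ : ℂ} {r R : ℝ} (hr : 0 < r) (hrR : r < R)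
    (hA : P.IsAdapted f (ball z₀ r) (ball z₀ R)) : ∀ x ∈ P.I, (x : ℂ) ∈ ball z₀ R := by
  obtain ⟨x₀, hx₀, hmax⟩ := (isCompact_Icc (a := P.a) (b := P.b)).exists_isMaxOn
    (nonempty_Icc.2 P.a_lt_b.le) (f := fun x : ℝ => ‖(x : ℂ) - z₀‖)
    (by fun_prop : Continuous fun x : ℝ => ‖(x : ℂ) - z₀‖).continuousOn
  have hle : ∀ x ∈ P.I, ‖(x : ℂ) - z₀‖ ≤ ‖(x₀ : ℂ) - z₀‖ := fun x hx => hmax hx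
  set m := ‖(x₀ : ℂ) - z₀‖
  suffices hlt : m < R from fun x hx => mem_ball_iff_norm.2 ((hle x hx).trans_lt hlt)
  by_contra! hRm
  obtain ⟨k, hk⟩ : ∃ k, x₀ ∈ Icc (P.left k) (P.right k) := by
    rw [← mem_iUnion, P.iUnion_eq]
    exact hx₀
  set a : ℂ := (P.slope f k : ℂ)⁻¹
  set c : ℂ := P.invBranch f k k z₀ - z₀
  have hac : ‖a‖ * R + ‖c‖ ≤ r := by
    refine norm_mul_add_norm_le_of_mapsTo (z₀ := z₀) (hr.trans hrR) fun z hz => ?_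
    rw [← invBranch_sub_center]
    exact mem_ball_iff_norm.1 (mapsTo_invBranch hM hE hPL hA k k hz)
  have ha : ‖a‖ < 1 := by
    rw [norm_inv, Complex.norm_real]
    exact inv_lt_one_of_one_lt₀ (one_lt_abs_slope hE k)
  have hint : ∀ x ∈ Ioo (P.left k) (P.right k), ‖(x : ℂ) - z₀‖ ≤ ‖a‖ * m + ‖c‖ := by
    intro x hx
    have h1 : (x : ℂ) - z₀ = a * ((f x : ℂ) - z₀) + c := by
      rw [← invBranch_sub_center, invBranch_apply_of_mem hE hPL k hx]
    rw [h1]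
    refine (norm_add_le _ _).trans ?_
    rw [norm_mul]
    gcongr
    exact hle _ (hM.mapsTo (int_subset k hx))
  have hm_le : m ≤ ‖a‖ * m + ‖c‖ := by
    rw [← closure_Ioo (P.left_lt_right k).ne] at hk
    exact ContinuousWithinAt.closure_le (f := fun x : ℝ => ‖(x : ℂ) - z₀‖)
      (g := fun _ => ‖a‖ * m + ‖c‖) hk (by fun_prop) (by fun_prop) hint
  nlinarith [mul_nonneg (sub_nonneg.2 ha.le) (sub_nonneg.2 hRm)]

/-- Away from the images of the endpoints of the partition, the preimages of a point of the `k`-th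
partition element are its images under the inverse branches with a transition into `k`. -/
theorem setOf_preimage_eq_image (hM : P.IsMarkovMap f)
    (hE : P.IsExpanding f) (hPL : P.IsPiecewiseLinear f) {x : ℝ} {k : Fin N} (hx : x ∈ P.int k)
    (hx' : x ∉ f '' P.endpoints) {g : Fin N → ℝ}
    (hg : ∀ l, g l = (x - P.intercept f l) / P.slope f l) :
    {y | y ∈ P.I ∧ f y = x} = g '' {l | P.transitionMatrix f l k = 1} ∧
      ∀ l, P.transitionMatrix f l k = 1 → g l ∈ P.int l := by
  have hinv : ∀ {l : Fin N} {y : ℝ}, y ∈ P.int l → f y = x → g l = y := by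
    intro l y hy hyx
    rw [hg, ← hyx, apply_eq hPL hy, add_sub_cancel_right,
      mul_div_cancel_left₀ _ (slope_ne_zero hE l)]
  refine ⟨?_, ?_⟩
  · ext y
    constructor
    · rintro ⟨hy, hyx⟩
      obtain ⟨l, hl⟩ := exists_mem_int hy fun h => hx' ⟨y, h, hyx⟩
      refine ⟨l, transitionMatrix_eq_one_iff.2 ((hM.markov l k).resolve_left ?_), hinv hl hyx⟩
      exact Set.Nonempty.ne_empty ⟨x, ⟨y, hl, hyx⟩, hx⟩
    · rintro ⟨l, hl, rfl⟩
      obtain ⟨y, hy, hyx⟩ := transitionMatrix_eq_one_iff.1 hl hx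
      rw [hinv hy hyx]
      exact ⟨int_subset l hy, hyx⟩
  · intro l hl
    obtain ⟨y, hy, hyx⟩ := transitionMatrix_eq_one_iff.1 hl hx
    rw [hinv hy hyx]
    exact hy

/-- The coefficient with which the `l`-th component of a tuple enters the `k`-th component of its
image under the transfer operator. -/
noncomputable def transferWeight (P : IntervalPartition N) (f : ℝ → ℝ) (β : ℝ) (k l : Fin N) : ℂ :=
  ((P.transitionMatrix f l k / |P.slope f l| ^ β : ℝ) : ℂ)

/-- Away from finitely many points the Perron-Frobenius sum is a sum over inverse branches. Only
the values of `u` inside the partition elements matter, given there by functions `v l` on `ℂ`. -/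
theorem perronFrobenius_apply (hM : P.IsMarkovMap f)
    (hE : P.IsExpanding f) (hPL : P.IsPiecewiseLinear f) (β : ℝ) {x : ℝ} {k : Fin N}
    (hx : x ∈ P.int k) (hx' : x ∉ f '' P.endpoints) {u : ℝ → ℂ} {v : Fin N → ℂ → ℂ}
    (huv : ∀ l, ∀ y ∈ P.int l, u y = v l y) :
    P.perronFrobenius f β u x =
      ∑ l, P.transferWeight f β k l * v l (P.invBranch f k l x) := by
  classical
  set g : Fin N → ℝ := fun l => (x - P.intercept f l) / P.slope f l with hg
  obtain ⟨hset, hint⟩ := setOf_preimage_eq_image hM hE hPL hx hx' (fun l => rfl : ∀ l, g l = _)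
  have hinj : InjOn g {l | P.transitionMatrix f l k = 1} := fun l hl l' hl' h =>
    eq_of_mem_int (hint l hl) (h ▸ hint l' hl')
  rw [perronFrobenius, hset, finsum_mem_image hinj, finsum_eq_sum_of_fintype]
  refine Finset.sum_congr rfl fun l _ => ?_
  rw [finsum_eq_if]
  have hgl : (g l : ℂ) = P.invBranch f k l x := by
    rw [hg, invBranch]
    push_cast
    rfl
  by_cases hl : P.transitionMatrix f l k = 1
  · have hmem : l ∈ {l | P.transitionMatrix f l k = 1} := hl
    rw [if_pos hmem, huv l _ (hint l hl), (hasDerivAt_slope hPL (hint l hl)).deriv, hgl,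
      transferWeight, hl]
    push_cast
    ring
  · have h0 : P.transitionMatrix f l k = 0 :=
      transitionMatrix_eq_zero_iff.2 fun h => hl (transitionMatrix_eq_one_iff.2 h)
    have hmem : l ∉ {l | P.transitionMatrix f l k = 1} := hl
    rw [if_neg hmem, transferWeight, h0]
    simp

theorem piecewiseFun_apply {D : Set ℂ} (h : TupleHolSpace N D) {x : ℝ} {k : Fin N}
    (hx : x ∈ P.int k) : P.piecewiseFun h x = boundedHolomorphic.zeroExtend (h k) x := by
  classical
  rw [piecewiseFun, Finset.sum_eq_single k]
  · by_cases hD : (x : ℂ) ∈ D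
    · rw [dif_pos ⟨hx, hD⟩, boundedHolomorphic.zeroExtend_of_mem _ hD]
    · rw [dif_neg fun h => hD h.2, boundedHolomorphic.zeroExtend, dif_neg hD]
  · intro l _ hl
    rw [dif_neg fun h => hl (eq_of_mem_int h.1 hx)]
  · exact fun h => absurd (Finset.mem_univ k) h

end IntervalPartition

/-! ### Weighted composition operators on a disk -/

section WeightedComposition

open boundedHolomorphic

variable {N : ℕ}

/-- The operator on tuples of bounded holomorphic functions whose `k`-th component is
`∑ l, w k l * h l ∘ φ l`. -/
noncomputable def weightedComp {D : Set ℂ} (w : Fin N → Fin N → ℂ) (φ : Fin N → ℂ → ℂ)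
    (hφ : ∀ l, DifferentiableOn ℂ (φ l) D) (hmaps : ∀ l, MapsTo (φ l) D D) :
    TupleHolSpace N D →L[ℂ] TupleHolSpace N D :=
  ContinuousLinearMap.pi fun k => ∑ l, w k l •
    (compCLM (φ l) (hφ l) (hmaps l)).comp (ContinuousLinearMap.proj l)

theorem weightedComp_apply {D : Set ℂ} {w : Fin N → Fin N → ℂ} {φ : Fin N → ℂ → ℂ}
    (hφ : ∀ l, DifferentiableOn ℂ (φ l) D) (hmaps : ∀ l, MapsTo (φ l) D D)
    (h : TupleHolSpace N D) (k : Fin N) (z : D) :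
    (weightedComp w φ hφ hmaps h k).1 z = ∑ l, w k l * (h l).1 ⟨φ l z, hmaps l z.2⟩ := by
  simp [weightedComp]

section Disk

variable {z₀ : ℂ} {R : ℝ} {M : ℕ}

/-- The tuple of polynomials in `z - z₀` of degree less than `M` whose `k`-th component has
coefficients `v (m, k)`. -/
noncomputable def polynomialTuple (N : ℕ) (z₀ : ℂ) (R : ℝ) (M : ℕ) :
    (Fin M × Fin N → ℂ) →ₗ[ℂ] TupleHolSpace N (ball z₀ R) :=
  LinearMap.pi fun k => ∑ m : Fin M,
    (LinearMap.proj (m, k) : (Fin M × Fin N → ℂ) →ₗ[ℂ] ℂ).smulRight (monomial z₀ R m)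

theorem polynomialTuple_apply (v : Fin M × Fin N → ℂ) (k : Fin N) (z : ball z₀ R) :
    (polynomialTuple N z₀ R M v k).1 z = ∑ m : Fin M, v (m, k) * ((z : ℂ) - z₀) ^ (m : ℕ) := by
  simp [polynomialTuple]

theorem polynomialTuple_injective (hR : 0 < R) :
    Function.Injective (polynomialTuple N z₀ R M) := by
  rw [← LinearMap.ker_eq_bot, LinearMap.ker_eq_bot']
  intro v hv
  ext ⟨m, k⟩
  let p : Polynomial ℂ := ∑ m : Fin M, Polynomial.monomial (m : ℕ) (v (m, k))
  have hcoeff : p.coeff m = v (m, k) := by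
    simp only [p, Polynomial.finsetSum_coeff, Polynomial.coeff_monomial, Fin.val_inj]
    simp
  have hroots : {t | p.IsRoot t}.Infinite := by
    refine (infinite_of_mem_nhds (0 : ℂ) (ball_mem_nhds 0 hR)).mono fun t ht => ?_
    have hmem : z₀ + t ∈ ball z₀ R := by
      rw [mem_ball_iff_norm, add_sub_cancel_left]
      exact mem_ball_zero_iff.1 ht
    have h1 := polynomialTuple_apply v k ⟨z₀ + t, hmem⟩
    rw [hv] at h1
    simp only [add_sub_cancel_left] at h1
    change p.eval t = 0
    rw [Polynomial.eval_finsetSum]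
    simp only [Polynomial.eval_monomial]
    exact h1.symm
  rw [← hcoeff, Polynomial.eq_zero_of_infinite_isRoot p hroots]
  simp

/-- The Taylor coefficients of order less than `M` of all components of a tuple. -/
noncomputable def taylorCoeffs (N : ℕ) (z₀ : ℂ) (hR : 0 < R) (M : ℕ) :
    TupleHolSpace N (ball z₀ R) →L[ℂ] (Fin M × Fin N → ℂ) :=
  ContinuousLinearMap.pi fun i => (taylorCoeff hR i.1).comp (ContinuousLinearMap.proj i.2)

/-- The operator sending a tuple to the tuple of its Taylor polynomials of degree less than `M`. -/
noncomputable def taylorProj (N : ℕ) (z₀ : ℂ) (hR : 0 < R) (M : ℕ) :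
    TupleHolSpace N (ball z₀ R) →L[ℂ] TupleHolSpace N (ball z₀ R) :=
  (LinearMap.toContinuousLinearMap (polynomialTuple N z₀ R M)).comp (taylorCoeffs N z₀ hR M)

theorem taylorProj_eq (hR : 0 < R) (h : TupleHolSpace N (ball z₀ R)) :
    taylorProj N z₀ hR M h = polynomialTuple N z₀ R M (taylorCoeffs N z₀ hR M h) := rfl

theorem taylorProj_apply (hR : 0 < R) (h : TupleHolSpace N (ball z₀ R)) (k : Fin N)
    (z : ball z₀ R) : (taylorProj N z₀ hR M h k).1 z =
      ∑ m ∈ Finset.range M, taylorCoeff hR m (h k) * ((z : ℂ) - z₀) ^ m := by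
  rw [taylorProj_eq, polynomialTuple_apply, Finset.sum_range]
  rfl

theorem isCompactOperator_taylorProj (hR : 0 < R) :
    IsCompactOperator (taylorProj N z₀ hR M) :=
  ((isCompactOperator_id (E := Fin M × Fin N → ℂ)).clm_comp
    (LinearMap.toContinuousLinearMap (polynomialTuple N z₀ R M))).comp_clm
      (taylorCoeffs N z₀ hR M)

variable {r : ℝ} {w : Fin N → Fin N → ℂ} {φ : Fin N → ℂ → ℂ}

/-- The contraction of the disk makes the operator insensitive to high Taylor coefficients, up
to an error that decays geometrically. -/
theorem norm_weightedComp_sub_comp_taylorProj_le (hr : 0 < r) (hrR : r < R)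
    (hφ : ∀ l, DifferentiableOn ℂ (φ l) (ball z₀ R))
    (hmaps : ∀ l, MapsTo (φ l) (ball z₀ R) (ball z₀ R))
    (hmaps' : ∀ l, MapsTo (φ l) (ball z₀ R) (ball z₀ r)) (M : ℕ) :
    ‖weightedComp w φ hφ hmaps -
        (weightedComp w φ hφ hmaps).comp (taylorProj N z₀ (hr.trans hrR) M)‖ ≤
      (∑ k, ∑ l, ‖w k l‖) / (1 - r / R) * (r / R) ^ M := by
  have hR := hr.trans hrR
  have hθ : 0 < 1 - r / R := sub_pos.2 ((div_lt_one hR).2 hrR)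
  refine ContinuousLinearMap.opNorm_le_bound _ (by positivity) fun h => ?_
  have hnn : 0 ≤ ‖h‖ := norm_nonneg h
  rw [pi_norm_le_iff_of_nonneg (by positivity)]
  intro k
  refine norm_le_of_forall (by positivity) fun z => ?_
  have hval : ((weightedComp w φ hφ hmaps -
      (weightedComp w φ hφ hmaps).comp (taylorProj N z₀ hR M)) h k).1 z =
      ∑ l, w k l * ((h l).1 ⟨φ l z, hmaps l z.2⟩ -
        (taylorProj N z₀ hR M h l).1 ⟨φ l z, hmaps l z.2⟩) := by
    simp only [mul_sub, Finset.sum_sub_distrib]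
    rw [← weightedComp_apply, ← weightedComp_apply]
    rfl
  rw [hval]
  calc ‖∑ l, w k l * ((h l).1 ⟨φ l z, hmaps l z.2⟩ -
        (taylorProj N z₀ hR M h l).1 ⟨φ l z, hmaps l z.2⟩)‖
      ≤ ∑ l, ‖w k l‖ * (‖h‖ * (r / R) ^ M / (1 - r / R)) := by
        refine norm_sum_le_of_le _ fun l _ => ?_
        rw [norm_mul]
        refine mul_le_mul_of_nonneg_left ?_ (norm_nonneg _)
        rw [norm_sub_rev, taylorProj_apply]
        refine (norm_taylorPolynomial_sub_le hr hrR (h l) M _ (hmaps' l z.2)).trans ?_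
        have hl : ‖h l‖ ≤ ‖h‖ := norm_le_pi_norm h l
        generalize ‖h l‖ = x at hl
        generalize ‖h‖ = y at hl
        gcongr
    _ = (∑ l, ‖w k l‖) * (‖h‖ * (r / R) ^ M / (1 - r / R)) := by rw [Finset.sum_mul]
    _ ≤ (∑ k, ∑ l, ‖w k l‖) * (‖h‖ * (r / R) ^ M / (1 - r / R)) := by
        refine mul_le_mul_of_nonneg_right ?_ (by positivity)
        exact Finset.single_le_sum (f := fun k => ∑ l, ‖w k l‖)
          (fun k _ => Finset.sum_nonneg fun l _ => norm_nonneg _) (Finset.mem_univ k)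
    _ = (∑ k, ∑ l, ‖w k l‖) / (1 - r / R) * (r / R) ^ M * ‖h‖ := by ring

theorem tendsto_geometric_bound (hr : 0 < r) (hrR : r < R) (C : ℝ) :
    Filter.Tendsto (fun M : ℕ => C * (r / R) ^ M) Filter.atTop (nhds 0) := by
  have hR := hr.trans hrR
  simpa using (tendsto_pow_atTop_nhds_zero_of_lt_one (div_nonneg hr.le hR.le)
    ((div_lt_one hR).2 hrR)).const_mul C

theorem isCompactOperator_weightedComp (hr : 0 < r) (hrR : r < R)
    (hφ : ∀ l, DifferentiableOn ℂ (φ l) (ball z₀ R))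
    (hmaps : ∀ l, MapsTo (φ l) (ball z₀ R) (ball z₀ R))
    (hmaps' : ∀ l, MapsTo (φ l) (ball z₀ R) (ball z₀ r)) :
    IsCompactOperator (weightedComp w φ hφ hmaps) := by
  have : CompleteSpace (boundedHolomorphic (ball z₀ R)) :=
    (boundedHolomorphic.isClosed isOpen_ball).completeSpace_coe
  exact isCompactOperator_of_norm_sub_comp_le
    (fun M => isCompactOperator_taylorProj (hr.trans hrR))
    (fun M => norm_weightedComp_sub_comp_taylorProj_le hr hrR hφ hmaps hmaps' M)
    (tendsto_geometric_bound hr hrR _)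

/-- The matrix, in the basis of monomials `(z - z₀) ^ m` of degree less than `M`, of the weighted
composition operator with the affine maps `z ↦ z₀ + a l * (z - z₀) + c l`. -/
def monomialMatrix (w : Fin N → Fin N → ℂ) (a c : Fin N → ℂ) (M : ℕ) :
    Matrix (Fin M × Fin N) (Fin M × Fin N) ℂ :=
  Matrix.of fun i j => w i.2 j.2 *
    (a j.2 ^ (i.1 : ℕ) * c j.2 ^ ((j.1 : ℕ) - i.1) * ((j.1 : ℕ).choose i.1 : ℂ))

theorem monomialMatrix_blockTriangular (a c : Fin N → ℂ) :
    (monomialMatrix w a c M).BlockTriangular Prod.fst := by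
  intro i j hij
  have : (j.1 : ℕ).choose i.1 = 0 := Nat.choose_eq_zero_of_lt hij
  simp [monomialMatrix, this]

theorem affine_pow_eq_sum (a c t : ℂ) (n : Fin M) :
    (a * t + c) ^ (n : ℕ) =
      ∑ m : Fin M, a ^ (m : ℕ) * c ^ ((n : ℕ) - m) * ((n : ℕ).choose m : ℂ) * t ^ (m : ℕ) := by
  rw [Fin.sum_univ_eq_sum_range
    (fun m => a ^ m * c ^ ((n : ℕ) - m) * ((n : ℕ).choose m : ℂ) * t ^ m) M,
    add_pow]
  refine Finset.sum_subset_zero_on_sdiff (Finset.range_subset_range.2 n.2) ?_ ?_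
  · intro m hm
    have : (n : ℕ) < m := by
      have := (Finset.mem_sdiff.1 hm).2
      rw [Finset.mem_range] at this
      omega
    simp [Nat.choose_eq_zero_of_lt this]
  · intro m _
    rw [mul_pow]
    ring

/-- Affine substitutions do not raise degrees, so tuples of polynomials of degree less than `M` form
an invariant subspace, on which the operator acts by `monomialMatrix`. -/
theorem weightedComp_polynomialTuple {a c : Fin N → ℂ}
    (hφ : ∀ l, DifferentiableOn ℂ (φ l) (ball z₀ R))
    (hmaps : ∀ l, MapsTo (φ l) (ball z₀ R) (ball z₀ R))
    (haff : ∀ l z, φ l z - z₀ = a l * (z - z₀) + c l) (v : Fin M × Fin N → ℂ) :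
    weightedComp w φ hφ hmaps (polynomialTuple N z₀ R M v) =
      polynomialTuple N z₀ R M (Matrix.toLin' (monomialMatrix w a c M) v) := by
  funext k
  refine Subtype.ext (BoundedContinuousFunction.ext fun z => ?_)
  rw [weightedComp_apply, polynomialTuple_apply]
  simp only [polynomialTuple_apply, haff, affine_pow_eq_sum, Matrix.toLin'_apply, Matrix.mulVec,
    dotProduct, Fintype.sum_prod_type, monomialMatrix, Matrix.of_apply, Finset.mul_sum,
    Finset.sum_mul]
  rw [Finset.sum_comm]
  simp only [Finset.sum_comm (s := (Finset.univ : Finset (Fin N)))]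
  rw [Finset.sum_comm]
  refine Finset.sum_congr rfl fun m _ => Finset.sum_congr rfl fun n _ =>
    Finset.sum_congr rfl fun l _ => ?_
  ring

/-- Generalised eigenvectors for `μ` are tuples of polynomials of degree less than `M` as soon as
the operator is within `|μ|` of its composition with the Taylor projection, so that algebraic
multiplicities are those of a block triangular matrix. -/
theorem finrank_maxGenEigenspace_weightedComp [Nonempty (Fin N)] {a c : Fin N → ℂ} (hr : 0 < r)
    (hrR : r < R)
    (hφ : ∀ l, DifferentiableOn ℂ (φ l) (ball z₀ R))
    (hmaps : ∀ l, MapsTo (φ l) (ball z₀ R) (ball z₀ R))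
    (hmaps' : ∀ l, MapsTo (φ l) (ball z₀ R) (ball z₀ r))
    (haff : ∀ l z, φ l z - z₀ = a l * (z - z₀) + c l) {μ : ℂ}
    (hμ : (∑ k, ∑ l, ‖w k l‖) / (1 - r / R) * (r / R) ^ M < ‖μ‖) :
    FiniteDimensional ℂ (genEigenspace
        (weightedComp w φ hφ hmaps : TupleHolSpace N (ball z₀ R) →ₗ[ℂ] _) μ) ∧
      Module.finrank ℂ (genEigenspace
        (weightedComp w φ hφ hmaps : TupleHolSpace N (ball z₀ R) →ₗ[ℂ] _) μ) =
      ∑ m ∈ Finset.range M, Module.finrank ℂ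
        (genEigenspace (Matrix.toLin' (Matrix.of fun k l => w k l * a l ^ m)) μ) := by
  have hle : genEigenspace (weightedComp w φ hφ hmaps : TupleHolSpace N (ball z₀ R) →ₗ[ℂ] _) μ ≤
      LinearMap.range (polynomialTuple N z₀ R M) := by
    refine maxGenEigenspace_le_of_norm_sub_comp_lt ?_ ?_
      ((norm_weightedComp_sub_comp_taylorProj_le hr hrR hφ hmaps hmaps' M).trans_lt hμ)
    · rintro _ ⟨v, rfl⟩
      exact ⟨_, (weightedComp_polynomialTuple hφ hmaps haff v).symm⟩
    · intro u
      exact ⟨_, (taylorProj_eq _ u).symm⟩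
  refine ⟨Submodule.finiteDimensional_of_le hle, ?_⟩
  rw [genEigenspace, finrank_maxGenEigenspace_eq_of_intertwining
    (polynomialTuple_injective (hr.trans hrR))
    (fun v => weightedComp_polynomialTuple hφ hmaps haff v) hle]
  refine finrank_maxGenEigenspace_toLin'_blockTriangular _ _
    (monomialMatrix_blockTriangular a c) (fun m k l => ?_) μ
  simp [monomialMatrix]

end Disk

end WeightedComposition

/-! ### The transfer operator -/

namespace IntervalPartition

open boundedHolomorphic

variable {N : ℕ} {P : IntervalPartition N} {f : ℝ → ℝ}

theorem differentiable_invBranch (k l : Fin N) : Differentiable ℂ (P.invBranch f k l) := by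
  unfold invBranch
  fun_prop

/-- The points where the two sides may differ are endpoints of partition elements and their
images. -/
theorem isTransferOperator_weightedComp (hM : P.IsMarkovMap f) (hE : P.IsExpanding f)
    (hPL : P.IsPiecewiseLinear f) (β : ℝ) {D : Set ℂ} (hD : ∀ x ∈ P.I, (x : ℂ) ∈ D)
    {φ : Fin N → ℂ → ℂ} (hφ : ∀ l, DifferentiableOn ℂ (φ l) D) (hmaps : ∀ l, MapsTo (φ l) D D)
    (hφP : ∀ k l, φ l = P.invBranch f k l) :
    P.IsTransferOperator f β (weightedComp (P.transferWeight f β) φ hφ hmaps) := by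
  intro h
  refine (P.finite_endpoints.union (P.finite_endpoints.image f)).subset ?_
  rintro x ⟨hxI, hne⟩
  by_contra hx
  rw [mem_union, not_or] at hx
  obtain ⟨k, hk⟩ := exists_mem_int hxI hx.1
  refine hne ?_
  rw [perronFrobenius_apply hM hE hPL β hk hx.2 (fun l y hy => piecewiseFun_apply h hy),
    piecewiseFun_apply _ hk, zeroExtend_of_mem _ (hD x hxI), weightedComp_apply]
  refine Finset.sum_congr rfl fun l _ => ?_
  rw [← zeroExtend_of_mem, hφP k l]

/-- Two operators with the defining property give functions that agree at all but finitely many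
points of each partition element, so the identity theorem applies. -/
theorem IsTransferOperator.unique {z₀ : ℂ} {R : ℝ} (hD : ∀ x ∈ P.I, (x : ℂ) ∈ ball z₀ R) {β : ℝ}
    {L L' : TupleHolSpace N (ball z₀ R) →L[ℂ] TupleHolSpace N (ball z₀ R)}
    (hL : P.IsTransferOperator f β L) (hL' : P.IsTransferOperator f β L') : L = L' := by
  refine ContinuousLinearMap.ext fun h => funext fun k => ?_
  set x₀ := (P.left k + P.right k) / 2
  have hx₀ : x₀ ∈ P.int k := mem_int_midpoint k
  refine eq_of_frequently_eq (hD x₀ (int_subset k hx₀)) ?_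
  have hev : ∀ᶠ x : ℝ in nhdsWithin x₀ {x₀}ᶜ,
      zeroExtend (L h k) (x : ℂ) = zeroExtend (L' h k) (x : ℂ) := by
    have h1 : ∀ᶠ x in nhdsWithin x₀ {x₀}ᶜ, x ∈ P.int k :=
      mem_nhdsWithin_of_mem_nhds (isOpen_Ioo.mem_nhds hx₀)
    have h2 := nhdsNE_le_cofinite x₀ (hL h).compl_mem_cofinite
    have h3 := nhdsNE_le_cofinite x₀ (hL' h).compl_mem_cofinite
    filter_upwards [h1, h2, h3] with x hx hx2 hx3
    have hxI := int_subset k hx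
    have e2 : P.piecewiseFun (L h) x = P.perronFrobenius f β (P.piecewiseFun h) x := by
      by_contra hne
      exact hx2 ⟨hxI, hne⟩
    have e3 : P.piecewiseFun (L' h) x = P.perronFrobenius f β (P.piecewiseFun h) x := by
      by_contra hne
      exact hx3 ⟨hxI, hne⟩
    rw [← piecewiseFun_apply _ hx, ← piecewiseFun_apply _ hx, e2, e3]
  have htend : Filter.Tendsto (fun x : ℝ => (x : ℂ)) (nhdsWithin x₀ {x₀}ᶜ)
      (nhdsWithin (x₀ : ℂ) {(x₀ : ℂ)}ᶜ) := by
    refine tendsto_nhdsWithin_iff.2 ⟨?_, ?_⟩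
    · exact (Complex.continuous_ofReal.tendsto x₀).mono_left nhdsWithin_le_nhds
    · filter_upwards [self_mem_nhdsWithin] with x hx
      simpa using hx
  exact htend.frequently hev.frequently

theorem T_self_eq (β : ℝ) (m : ℕ) :
    P.T f β m m = Matrix.of fun k l => P.transferWeight f β k l * (P.slope f l : ℂ)⁻¹ ^ m := by
  ext k l
  simp only [T, transferWeight, Matrix.of_apply, Nat.sub_self, pow_zero, Nat.choose_self]
  push_cast
  rw [mul_one, mul_one, div_mul_eq_div_div, inv_pow, ← div_eq_mul_inv]

end IntervalPartition

theorem proposition3 {N : ℕ} (P : IntervalPartition N) (f : ℝ → ℝ)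
    (hM : P.IsMarkovMap f) (hE : P.IsExpanding f) (hPL : P.IsPiecewiseLinear f)
    (z₀ : ℂ) (r R : ℝ) (hr : 0 < r) (hrR : r < R)
    (hA : P.IsAdapted f (Metric.ball z₀ r) (Metric.ball z₀ R)) (β : ℝ) :
    -- the interval lies in the large disk, and the transfer operator is well defined on `H(D_R)`
    (∀ x ∈ P.I, (x : ℂ) ∈ Metric.ball z₀ R) ∧
    (∃! L : TupleHolSpace N (Metric.ball z₀ R) →L[ℂ] TupleHolSpace N (Metric.ball z₀ R),
      P.IsTransferOperator f β L) ∧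
    ∀ L : TupleHolSpace N (Metric.ball z₀ R) →L[ℂ] TupleHolSpace N (Metric.ball z₀ R),
      P.IsTransferOperator f β L →
      -- it is compact
      IsCompactOperator L ∧
      -- nonzero eigenvalues are those of the diagonal blocks, with algebraic multiplicities
      ∀ μ : ℂ, μ ≠ 0 →
        (Module.End.HasEigenvalue (L : TupleHolSpace N (Metric.ball z₀ R) →ₗ[ℂ] _) μ ↔
          ∃ m : ℕ, Module.End.HasEigenvalue (Matrix.toLin' (P.T f β m m)) μ) ∧
        {m : ℕ | Module.End.HasEigenvalue (Matrix.toLin' (P.T f β m m)) μ}.Finite ∧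
        FiniteDimensional ℂ
          (genEigenspace (L : TupleHolSpace N (Metric.ball z₀ R) →ₗ[ℂ] _) μ) ∧
        Module.finrank ℂ (genEigenspace (L : TupleHolSpace N (Metric.ball z₀ R) →ₗ[ℂ] _) μ) =
          ∑ᶠ m : ℕ, Module.finrank ℂ (genEigenspace (Matrix.toLin' (P.T f β m m)) μ) := by
  have hI := IntervalPartition.mem_ball_of_isAdapted hM hE hPL hr hrR hA
  have hN : Nonempty (Fin N) := P.nonempty_index
  -- `invBranch` ignores its first index
  set φ : Fin N → ℂ → ℂ := fun l => P.invBranch f l l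
  have hdiff : ∀ l, DifferentiableOn ℂ (φ l) (Metric.ball z₀ R) := fun l =>
    (IntervalPartition.differentiable_invBranch l l).differentiableOn
  have hmaps' : ∀ l, MapsTo (φ l) (Metric.ball z₀ R) (Metric.ball z₀ r) := fun l =>
    IntervalPartition.mapsTo_invBranch hM hE hPL hA l l
  have hmaps : ∀ l, MapsTo (φ l) (Metric.ball z₀ R) (Metric.ball z₀ R) := fun l =>
    (hmaps' l).mono_right (Metric.ball_subset_ball hrR.le)
  have hL₀ := IntervalPartition.isTransferOperator_weightedComp hM hE hPL β hI hdiff hmaps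
    fun k l => rfl
  refine ⟨hI, ⟨_, hL₀, fun L hL => hL.unique hI hL₀⟩, fun L hL => ?_⟩
  obtain rfl := hL.unique hI hL₀
  refine ⟨isCompactOperator_weightedComp hr hrR hdiff hmaps hmaps', fun μ hμ => ?_⟩
  set S : Module.End ℂ (TupleHolSpace N (Metric.ball z₀ R)) :=
    (weightedComp (P.transferWeight f β) φ hdiff hmaps :
      TupleHolSpace N (Metric.ball z₀ R) →ₗ[ℂ] TupleHolSpace N (Metric.ball z₀ R))
  set d : ℕ → ℕ := fun m => Module.finrank ℂ (genEigenspace (Matrix.toLin' (P.T f β m m)) μ)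
  have hd : ∀ m, Module.End.HasEigenvalue (Matrix.toLin' (P.T f β m m)) μ ↔ d m ≠ 0 := fun m => by
    rw [hasEigenvalue_iff_maxGenEigenspace_ne_bot, ne_eq, ne_eq, not_iff_not]
    exact Submodule.finrank_eq_zero.symm
  obtain ⟨M₀, hM₀⟩ := Filter.eventually_atTop.1 ((tendsto_geometric_bound hr hrR
    ((∑ k, ∑ l, ‖P.transferWeight f β k l‖) / (1 - r / R))).eventually_lt_const
      (norm_pos_iff.2 hμ))
  have hfin : ∀ M ≥ M₀, FiniteDimensional ℂ (genEigenspace S μ) ∧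
      Module.finrank ℂ (genEigenspace S μ) = ∑ m ∈ Finset.range M, d m := fun M hM' => by
    have h1 := finrank_maxGenEigenspace_weightedComp hr hrR hdiff hmaps hmaps'
      (fun l z => IntervalPartition.invBranch_sub_center l l z₀ z) (hM₀ M hM')
    refine ⟨h1.1, h1.2.trans (Finset.sum_congr rfl fun m _ => ?_)⟩
    simp only [d]
    rw [IntervalPartition.T_self_eq]
  have hfd : FiniteDimensional ℂ (genEigenspace S μ) := (hfin M₀ le_rfl).1
  -- the multiplicity is the sum over `m < M` for every large `M`, so later blocks contribute 0
  have hzero : ∀ m ≥ M₀, d m = 0 := fun m hm => by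
    have h1 := (hfin m hm).2
    have h2 := (hfin (m + 1) (hm.trans m.le_succ)).2
    rw [Finset.sum_range_succ, ← h1] at h2
    omega
  have hsupp : ∀ m, d m ≠ 0 → m < M₀ := fun m hm => by
    by_contra h
    exact hm (hzero m (not_lt.1 h))
  have hsum : Module.finrank ℂ (genEigenspace S μ) = ∑ᶠ m, d m := by
    rw [(hfin M₀ le_rfl).2]
    refine (finsum_eq_sum_of_support_subset _ fun m hm => ?_).symm
    exact Finset.mem_coe.2 (Finset.mem_range.2 (hsupp m hm))
  refine ⟨?_, ?_, hfd, hsum⟩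
  · rw [hasEigenvalue_iff_maxGenEigenspace_ne_bot, ne_eq, ← Submodule.finrank_eq_zero,
      (hfin M₀ le_rfl).2, Finset.sum_eq_zero_iff]
    push Not
    simp only [hd]
    exact ⟨fun ⟨m, _, hm⟩ => ⟨m, hm⟩,
      fun ⟨m, hm⟩ => ⟨m, Finset.mem_range.2 (hsupp m hm), hm⟩⟩
  · exact (finite_lt_nat M₀).subset fun m hm => hsupp m ((hd m).1 hm)
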